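/- Let $k$ be a field and let $X$ be a finite group with subgroups $G,M$ such that $X=GM$ is a factorisation, i.e. every element of $X$ is $us$ for unique $u\in G$, $s\in M$. For $s\in M$, $u\in G$ define $s\triangleright u\in G$ and $s\triangleleft u\in M$ by $su=(s\triangleright u)(s\triangleleft u)$. Let $Y=G\times M^{\mathrm{op}}$, identified as a set with $X$ by $(u,s)\leftrightarrow us$, so that the group law of $Y$ is $(us)\cdot(vt)=uvts$ for $u,v\in G$, $s,t\in M$. The groups $X$ and $Y$ form a matched pair with the left action of $X$ on the set $Y$ and the right action of $Y$ on the set $X$ given by \[ us\,\tilde\triangleright\, vt=us(vt)(us)^{-1}\ (\text{computed in }X),\qquad us\,\tilde\triangleleft\, vt=\big(((s\triangleleft v)ts^{-1})\triangleright u^{-1}\big)^{-1}(s\triangleleft v).\] Let $H=kX\,{\triangleright\!\!\!\blacktriangleleft}\, k(Y)$ be the associated bicrossproduct Hopf algebra, with basis $x\otimes\delta_y$ ($x\in X$, $y\in Y$) and structure maps \[ (x\otimes\delta_y)(x'\otimes\delta_{y'})=\delta_{y,\,x'\tilde\triangleright y'}\,(xx'\otimes\delta_{y'}),\qquad 1=\sum_{y\in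 Y}e\otimes\delta_y,\] \[ \Delta(x\otimes\delta_y)=\sum_{y_1\cdot y_2=y}x\otimes\delta_{y_1}\otimes (x\tilde\triangleleft y_1)\otimes\delta_{y_2},\qquad \epsilon(x\otimes\delta_y)=\delta_{y,e},\qquad S(x\otimes\delta_y)=(x\tilde\triangleleft y)^{-1}\otimes\delta_{(x\tilde\triangleright y)^{-1}},\] where products and inverses of indices of $\delta$ in these structure maps are taken in $Y$. In the formulas below all products and inverses are taken in $X$, and the index of each $\delta$ is then viewed as an element of $Y$. Then $H$ is quasitriangular with \[ \mathcal R=\sum_{u,v\in G,\ s,t\in M} v^{-1}\otimes\delta_{us}\otimes s^{-1}\otimes\delta_{(s\triangleright v)t}\ \in H\otimes H,\] that is, $\mathcal R$ is invertible, $(\Delta\otimes\mathrm{id})\mathcal R=\mathcal R_{13}\mathcal R_{23}$, $(\mathrm{id}\otimes\Delta)\mathcal R=\mathcal R_{13}\mathcal R_{12}$, and $\tau(\Delta h)=\mathcal R(\Delta h)\mathcal R^{-1}$ for all $h\in H$, where $\tau$ is the flip. The quantum inverse Killing form is \[ \mathcal R_{21}\mathcal R=\sum_{u,v\in G,\ s,p\in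 M} s^{-1}u^{-1}\otimes\delta_{u(s\triangleright v)(p\triangleleft u)u^{-1}}\otimes v^{-1}p^{-1}\otimes\delta_{pusp^{-1}},\] and it is non-degenerate as a bilinear functional on the dual $H^*$, $(\varphi,\psi)\mapsto(\varphi\otimes\psi)(\mathcal R_{21}\mathcal R)$. The element $\mathsf u=\sum (S\mathcal R^{(2)})\mathcal R^{(1)}$, where $\mathcal R=\sum\mathcal R^{(1)}\otimes\mathcal R^{(2)}$, equals $\sum_{x\in X}x\otimes\delta_x$ and is central in $H$. -/

import Mathlib

open scoped TensorProduct

/-- A matched pair of groups: a left action `▹` of `M` on the set `G` and a right action `◃` of `G`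
on the set `M`, compatible with the group laws. `lact s u` is `s ▹ u` and `ract s u` is `s ◃ u`. -/
structure MatchedPair (M G : Type*) [Group M] [Group G] where
  /-- `s ▹ u` -/
  lact : M → G → G
  /-- `s ◃ u` -/
  ract : M → G → M
  ract_one : ∀ s, ract s 1 = s
  ract_ract : ∀ s u v, ract (ract s u) v = ract s (u * v)
  one_ract : ∀ u, ract 1 u = 1
  mul_ract : ∀ s t u, ract (s * t) u = ract s (lact t u) * ract t u
  one_lact : ∀ u, lact 1 u = u
  lact_lact : ∀ s t u, lact s (lact t u) = lact (s * t) u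
  lact_one : ∀ s, lact s 1 = 1
  lact_mul : ∀ s u v, lact s (u * v) = lact s u * lact (ract s u) v

namespace MatchedPair

variable {M G : Type*} [Group M] [Group G] (P : MatchedPair M G)

theorem lact_injective (s : M) : Function.Injective (P.lact s) := by
  intro u v h
  have := congrArg (P.lact s⁻¹) h
  simpa [P.lact_lact, P.one_lact] using this

theorem ract_inv (s : M) (u : G) : (P.ract s u)⁻¹ = P.ract s⁻¹ (P.lact s u) := by
  rw [inv_eq_iff_mul_eq_one, mul_eq_one_iff_eq_inv, ← mul_eq_one_iff_eq_inv', ← P.mul_ract,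
    inv_mul_cancel, P.one_ract]

theorem lact_inv (s : M) (u : G) : (P.lact s u)⁻¹ = P.lact (P.ract s u) u⁻¹ := by
  rw [inv_eq_iff_mul_eq_one, ← P.lact_mul, mul_inv_cancel, P.lact_one]

end MatchedPair

/-- The vector space `kM ⊗ k(G)` of the bicrossproduct Hopf algebra `kM ▷◀ k(G)` of a matched pair
of groups with `G` finite, as the space of finite linear combinations of the symbols `s ⊗ δ_u`,
indexed by the pairs `(s, u)` in `M × G`. -/
def Bicross (k : Type*) [Field k] {M G : Type*} [Group M] [Group G] (_P : MatchedPair M G) :=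
  (M × G) →₀ k

noncomputable section

namespace Bicross

variable (k : Type*) [Field k] {M G : Type*} [Group M] [Group G] (P : MatchedPair M G)

instance : AddCommGroup (Bicross k P) := inferInstanceAs (AddCommGroup ((M × G) →₀ k))
instance : Module k (Bicross k P) := inferInstanceAs (Module k ((M × G) →₀ k))

/-- The basis of the elements `s ⊗ δ_u`. -/
def basis : Module.Basis (M × G) k (Bicross k P) := ⟨LinearEquiv.refl k ((M × G) →₀ k)⟩

variable {P}

/-- The basis element `s ⊗ δ_u` of `kM ▷◀ k(G)`. -/
def el (s : M) (u : G) : Bicross k P := basis k P (s, u)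

theorem basis_apply (p : M × G) : basis k P p = el k p.1 p.2 := rfl

variable {k} in
theorem hom_ext {N : Type*} [AddCommMonoid N] [Module k N] {f g : Bicross k P →ₗ[k] N}
    (h : ∀ s u, f (el k s u) = g (el k s u)) : f = g :=
  (basis k P).ext fun p => h p.1 p.2

variable (P)

open Classical in
/-- The product `(s ⊗ δ_u)(t ⊗ δ_v) = δ_{u, t ▹ v} (s t ⊗ δ_v)`, as a bilinear map. -/
def mulMap : Bicross k P →ₗ[k] Bicross k P →ₗ[k] Bicross k P :=
  (basis k P).constr k fun p => (basis k P).constr k fun q =>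
    if p.2 = P.lact q.1 q.2 then el k (p.1 * q.1) q.2 else 0

/-- The coproduct `Δ(s ⊗ δ_u) = ∑_{xy = u} s ⊗ δ_x ⊗ (s ◃ x) ⊗ δ_y`, where `y = x⁻¹ u`. -/
def comulMap [Fintype G] : Bicross k P →ₗ[k] Bicross k P ⊗[k] Bicross k P :=
  (basis k P).constr k fun p => ∑ x : G, el k p.1 x ⊗ₜ[k] el k (P.ract p.1 x) (x⁻¹ * p.2)

open Classical in
/-- The counit `ε(s ⊗ δ_u) = δ_{u, e}`. -/
def counitMap : Bicross k P →ₗ[k] k :=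
  (basis k P).constr k fun p => if p.2 = 1 then 1 else 0

/-- The antipode `S(s ⊗ δ_u) = (s ◃ u)⁻¹ ⊗ δ_{(s ▹ u)⁻¹}`. -/
def antipodeMap : Bicross k P →ₗ[k] Bicross k P :=
  (basis k P).constr k fun p => el k (P.ract p.1 p.2)⁻¹ (P.lact p.1 p.2)⁻¹

instance : Mul (Bicross k P) := ⟨fun a b => mulMap k P a b⟩

/-- The unit `1 = ∑_u e ⊗ δ_u`. -/
instance [Fintype G] : One (Bicross k P) := ⟨∑ u : G, el k 1 u⟩

variable {P}

theorem mul_def (a b : Bicross k P) : a * b = mulMap k P a b := rfl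

theorem one_def [Fintype G] : (1 : Bicross k P) = ∑ u : G, el k 1 u := rfl

open Classical in
theorem el_mul_el (s t : M) (u v : G) : (el k s u : Bicross k P) * el k t v =
    if u = P.lact t v then el k (s * t) v else 0 := by
  rw [mul_def, mulMap, el, Module.Basis.constr_basis, el, Module.Basis.constr_basis]

theorem comulMap_el [Fintype G] (s : M) (u : G) : comulMap k P (el k s u) =
    ∑ x : G, el k s x ⊗ₜ[k] el k (P.ract s x) (x⁻¹ * u) := by
  rw [comulMap, el, Module.Basis.constr_basis]

open Classical in
theorem counitMap_el (s : M) (u : G) :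
    counitMap k P (el k s u) = if u = 1 then 1 else 0 := by
  rw [counitMap, el, Module.Basis.constr_basis]

theorem antipodeMap_el (s : M) (u : G) :
    antipodeMap k P (el k s u) = el k (P.ract s u)⁻¹ (P.lact s u)⁻¹ := by
  rw [antipodeMap, el, Module.Basis.constr_basis]

variable {k} in
theorem induct {p : Bicross k P → Prop} (zero : p 0) (add : ∀ a b, p a → p b → p (a + b))
    (smul : ∀ (c : k) a, p a → p (c • a)) (ofEl : ∀ s u, p (el k s u)) (a : Bicross k P) : p a :=
  Submodule.span_induction (s := Set.range (basis k P)) (p := fun a _ => p a)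
    (by rintro _ ⟨q, rfl⟩; exact ofEl _ _) zero (fun _ _ _ _ => add _ _) (fun c _ _ => smul c _)
    ((basis k P).mem_span a)

variable (P)

instance : NonUnitalNonAssocRing (Bicross k P) where
  __ := (inferInstance : AddCommGroup (Bicross k P))
  left_distrib a b c := by simp [mul_def]
  right_distrib a b c := by simp [mul_def]
  zero_mul a := by simp [mul_def]
  mul_zero a := by simp [mul_def]

theorem smul_mul' (c : k) (a b : Bicross k P) : (c • a) * b = c • (a * b) := by simp [mul_def]

theorem mul_smul' (c : k) (a b : Bicross k P) : a * (c • b) = c • (a * b) := by simp [mul_def]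

instance [Fintype G] : Ring (Bicross k P) where
  __ := (inferInstance : NonUnitalNonAssocRing (Bicross k P))
  one := 1
  mul_assoc a b c := by
    induction a using induct with
    | zero => simp
    | add a a' h h' => simp [add_mul, h, h']
    | smul r a h => simp [smul_mul', h]
    | ofEl s u =>
    induction b using induct with
    | zero => simp
    | add a a' h h' => simp [add_mul, mul_add, h, h']
    | smul r a h => simp [smul_mul', mul_smul', h]
    | ofEl t v =>
    induction c using induct with
    | zero => simp
    | add a a' h h' => simp [mul_add, h, h']
    | smul r a h => simp [mul_smul', h]
    | ofEl r w =>
      simp only [el_mul_el]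
      by_cases h2 : v = P.lact r w
      · subst h2
        by_cases h1 : u = P.lact t (P.lact r w)
        · simp [h1, el_mul_el, P.lact_lact, mul_assoc]
        · have : u ≠ P.lact (t * r) w := by rwa [← P.lact_lact]
          simp [h1, el_mul_el, this]
      · by_cases h1 : u = P.lact t v <;> simp [h1, h2, el_mul_el]
  one_mul a := by
    induction a using induct with
    | zero => simp
    | add a a' h h' => simp [mul_add, h, h']
    | smul r a h => simp [mul_smul', h]
    | ofEl s u => classical simp [one_def, Finset.sum_mul, el_mul_el]
  mul_one a := by
    induction a using induct with
    | zero => simp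
    | add a a' h h' => simp [add_mul, h, h']
    | smul r a h => simp [smul_mul', h]
    | ofEl s u => classical simp [one_def, Finset.mul_sum, el_mul_el, P.one_lact]

instance [Fintype G] : Algebra k (Bicross k P) :=
  Algebra.ofModule (smul_mul' k P) (fun c a b => mul_smul' k P c a b)

instance [Fintype G] : Coalgebra k (Bicross k P) where
  comul := comulMap k P
  counit := counitMap k P
  coassoc := hom_ext fun s u => by
    classical
    simp only [LinearMap.comp_apply, comulMap_el, map_sum, LinearMap.rTensor_tmul,
      LinearMap.lTensor_tmul, TensorProduct.sum_tmul, TensorProduct.tmul_sum,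
      LinearEquiv.coe_coe, TensorProduct.assoc_tmul, P.ract_ract]
    rw [Finset.sum_comm]
    refine Finset.sum_congr rfl fun x _ => ?_
    refine Fintype.sum_equiv (Equiv.mulLeft x⁻¹) _ _ fun y => ?_
    simp [mul_assoc]
  rTensor_counit_comp_comul := hom_ext fun s u => by
    classical
    simp [comulMap_el, counitMap_el, TensorProduct.ite_tmul, P.ract_one]
  lTensor_counit_comp_comul := hom_ext fun s u => by
    classical
    simp [comulMap_el, counitMap_el, TensorProduct.tmul_ite, inv_mul_eq_one]

theorem comul_el [Fintype G] (s : M) (u : G) : Coalgebra.comul (R := k) (el k s u : Bicross k P) =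
    ∑ x : G, el k s x ⊗ₜ[k] el k (P.ract s x) (x⁻¹ * u) := comulMap_el k s u

open Classical in
theorem counit_el [Fintype G] (s : M) (u : G) :
    Coalgebra.counit (R := k) (el k s u : Bicross k P) = if u = 1 then 1 else 0 :=
  counitMap_el k s u

instance [Fintype G] : Bialgebra k (Bicross k P) where
  counit_one := by classical simp [one_def, counit_el]
  mul_compr₂_counit := hom_ext fun s u => hom_ext fun t v => by
    classical
    by_cases hv : v = 1
    · by_cases h : u = 1 <;> simp [el_mul_el, counit_el, hv, P.lact_one, h]
    · by_cases h : u = P.lact t v <;> simp [el_mul_el, counit_el, hv, h]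
  comul_one := by
    simp only [one_def, map_sum, comul_el, Algebra.TensorProduct.one_def, TensorProduct.sum_tmul,
      TensorProduct.tmul_sum, P.one_ract]
    rw [Finset.sum_comm]
    conv_rhs => rw [Finset.sum_comm]
    refine Finset.sum_congr rfl fun x _ => ?_
    exact Fintype.sum_equiv (Equiv.mulLeft x⁻¹) _ _ fun y => rfl
  mul_compr₂_comul := hom_ext fun s u => hom_ext fun t v => by
    classical
    simp only [LinearMap.compr₂_apply, LinearMap.mul_apply', LinearMap.compl₁₂_apply, comul_el,
      Finset.sum_mul_sum, Algebra.TensorProduct.tmul_mul_tmul, el_mul_el]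
    rw [Finset.sum_comm]
    by_cases h : u = P.lact t v
    · subst h
      rw [if_pos rfl, comul_el]
      refine Finset.sum_congr rfl fun y _ => ?_
      rw [Finset.sum_eq_single (P.lact t y)]
      · have : (P.lact t y)⁻¹ * P.lact t v = P.lact (P.ract t y) (y⁻¹ * v) := by
          rw [inv_mul_eq_iff_eq_mul, ← P.lact_mul, mul_inv_cancel_left]
        rw [if_pos rfl, if_pos this, P.mul_ract]
      · intro x _ hx
        rw [if_neg hx, TensorProduct.zero_tmul]
      · simp
    · rw [if_neg h, map_zero]
      symm
      refine Finset.sum_eq_zero fun y _ => Finset.sum_eq_zero fun x _ => ?_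
      by_cases hx : x = P.lact t y
      · rw [if_neg (c := x⁻¹ * u = _), TensorProduct.tmul_zero]
        intro h2
        apply h
        rw [inv_mul_eq_iff_eq_mul, hx, ← P.lact_mul, mul_inv_cancel_left] at h2
        exact h2
      · rw [if_neg hx, TensorProduct.zero_tmul]

instance [Fintype G] : HopfAlgebra k (Bicross k P) where
  antipode := antipodeMap k P
  mul_antipode_rTensor_comul := hom_ext fun s u => by
    classical
    simp only [LinearMap.comp_apply, comul_el, map_sum, LinearMap.rTensor_tmul,
      LinearMap.mul'_apply, antipodeMap_el, el_mul_el, counit_el, Algebra.linearMap_apply]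
    have key : ∀ x, (P.lact s x)⁻¹ = P.lact (P.ract s x) (x⁻¹ * u) ↔ u = 1 := fun x => by
      rw [inv_eq_iff_mul_eq_one, ← P.lact_mul, mul_inv_cancel_left]
      exact ⟨fun h => P.lact_injective s (h.trans (P.lact_one s).symm),
        fun h => h ▸ P.lact_one s⟩
    simp only [key, inv_mul_cancel]
    by_cases h : u = 1
    · simp only [h, if_true, mul_one, map_one, one_def]
      exact Fintype.sum_equiv (Equiv.inv G) _ _ fun x => rfl
    · simp [h]
  mul_antipode_lTensor_comul := hom_ext fun s u => by
    classical
    simp only [LinearMap.comp_apply, comul_el, map_sum, LinearMap.lTensor_tmul,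
      LinearMap.mul'_apply, antipodeMap_el, el_mul_el, counit_el, Algebra.linearMap_apply]
    have key : ∀ x, x = P.lact (P.ract (P.ract s x) (x⁻¹ * u))⁻¹
        (P.lact (P.ract s x) (x⁻¹ * u))⁻¹ ↔ u = 1 := fun x => by
      rw [P.lact_inv, P.lact_lact, inv_mul_cancel, P.one_lact, mul_inv_rev, inv_inv]
      exact ⟨fun h => inv_eq_one.1 (mul_eq_right.1 h.symm), fun h => by simp [h]⟩
    simp only [key]
    by_cases h : u = 1
    · subst h
      simp only [if_true, mul_one, map_one, one_def, P.ract_ract, mul_inv_cancel, P.ract_one,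
        ← P.lact_inv, inv_inv]
      exact Fintype.sum_bijective (P.lact s) (Finite.injective_iff_bijective.1 (P.lact_injective s))
        _ _ fun x => rfl
    · simp [h]

theorem antipode_el [Fintype G] (s : M) (u : G) :
    HopfAlgebra.antipode k (el k s u : Bicross k P) = el k (P.ract s u)⁻¹ (P.lact s u)⁻¹ :=
  antipodeMap_el k s u

end Bicross

namespace QuasiHopf

variable (k : Type*) {H : Type*} [Field k] [Ring H] [HopfAlgebra k H]

/-- `a ⊗ b ↦ a ⊗ b ⊗ 1` -/
def leg₁₂ : H ⊗[k] H →ₐ[k] H ⊗[k] (H ⊗[k] H) :=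
  Algebra.TensorProduct.map (AlgHom.id k H) Algebra.TensorProduct.includeLeft

/-- `a ⊗ b ↦ a ⊗ 1 ⊗ b` -/
def leg₁₃ : H ⊗[k] H →ₐ[k] H ⊗[k] (H ⊗[k] H) :=
  Algebra.TensorProduct.map (AlgHom.id k H) Algebra.TensorProduct.includeRight

/-- `a ⊗ b ↦ 1 ⊗ a ⊗ b` -/
def leg₂₃ : H ⊗[k] H →ₐ[k] H ⊗[k] (H ⊗[k] H) :=
  Algebra.TensorProduct.includeRight

/-- `R` is a quasitriangular structure (universal R-matrix) on the Hopf algebra `H`: it is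
invertible, `(Δ ⊗ id) R = R₁₃ R₂₃`, `(id ⊗ Δ) R = R₁₃ R₁₂` and `τ(Δ h) = R (Δ h) R⁻¹`. -/
structure IsQuasitriangular (R : H ⊗[k] H) : Prop where
  isUnit : IsUnit R
  comul_left : TensorProduct.assoc k H H H ((Coalgebra.comul (R := k)).rTensor H R) =
    leg₁₃ k R * leg₂₃ k R
  comul_right : (Coalgebra.comul (R := k)).lTensor H R = leg₁₃ k R * leg₁₂ k R
  comul_op : ∀ h : H, TensorProduct.comm k H H (Coalgebra.comul h) * R = R * Coalgebra.comul h

/-- The quantum inverse Killing form `R₂₁ R`. -/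
def killing (R : H ⊗[k] H) : H ⊗[k] H := TensorProduct.comm k H H R * R

/-- The Drinfeld element `∑ S(R⁽²⁾) R⁽¹⁾`, where `R = ∑ R⁽¹⁾ ⊗ R⁽²⁾`. -/
def drinfeld (R : H ⊗[k] H) : H :=
  LinearMap.mul' k H ((HopfAlgebra.antipode k).rTensor H (TensorProduct.comm k H H R))

/-- An element `Q` of `H ⊗ H` as the bilinear functional `(φ, ψ) ↦ (φ ⊗ ψ)(Q)` on the dual `H^*`. -/
def dualForm (Q : H ⊗[k] H) : LinearMap.BilinForm k (Module.Dual k H) :=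
  (TensorProduct.mk k (Module.Dual k H) (Module.Dual k H)).compr₂
    (LinearMap.applyₗ Q ∘ₗ TensorProduct.dualDistrib k H H)

end QuasiHopf

/-! A group factorisation `X = GM` is given by subgroups `G`, `M` such that each `x ∈ X` is `u s` for
unique `u ∈ G` and `s ∈ M`, which is `Subgroup.IsComplement' G M`. -/

namespace Factorisation

variable {X : Type*} [Group X] {G M : Subgroup X} (h : G.IsComplement' M)

/-- The component `u ∈ G` of `x = u s`. -/
def gPart (x : X) : G := (h.equiv x).1

/-- The component `s ∈ M` of `x = u s`. -/
def mPart (x : X) : M := (h.equiv x).2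

/-- The left action of `M` on `G`: `s u = (s ▹ u)(s ◃ u)`. -/
def lact (s : M) (u : G) : G := gPart h (s * u)

/-- The right action of `G` on `M`: `s u = (s ▹ u)(s ◃ u)`. -/
def ract (s : M) (u : G) : M := mPart h (s * u)

theorem gPart_mul_mPart (x : X) : (gPart h x : X) * mPart h x = x :=
  h.equiv_fst_mul_equiv_snd x

theorem part_unique {x : X} (u : G) (s : M) (hx : (u : X) * s = x) :
    gPart h x = u ∧ mPart h x = s := by
  have := h.1 (a₁ := (gPart h x, mPart h x)) (a₂ := (u, s))
    ((gPart_mul_mPart h x).trans hx.symm)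
  exact Prod.ext_iff.1 this

theorem gPart_mul_mul (u : G) (x : X) (s : M) : gPart h (u * x * s) = u * gPart h x :=
  (part_unique h (u * gPart h x) (mPart h x * s) (by
    conv_rhs => rw [← gPart_mul_mPart h x]
    simp [mul_assoc])).1

theorem gPart_coe_mul (u : G) (x : X) : gPart h (u * x) = u * gPart h x := by
  simpa using gPart_mul_mul h u x 1

theorem gPart_one : gPart h 1 = 1 := (part_unique h 1 1 (by simp)).1

/-- The identification of `X` with the set of the group `Y = G × Mᵒᵖ`, `us ↦ (u, s)`. The group law
of `Y` is `(us).(vt) = uvts`. -/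
def toY : X ≃ G × Mᵐᵒᵖ where
  toFun x := (gPart h x, MulOpposite.op (mPart h x))
  invFun y := y.1 * (y.2.unop : X)
  left_inv x := gPart_mul_mPart h x
  right_inv y := by
    obtain ⟨h1, h2⟩ := part_unique h y.1 y.2.unop rfl
    simp [h1, h2]

/-- The left action of `X` on the set `Y`: the adjoint action `us ▹ vt = us(vt)(us)⁻¹` of `X`, viewed
on `Y`. -/
def lactY (x : X) (y : G × Mᵐᵒᵖ) : G × Mᵐᵒᵖ := toY h (x * (toY h).symm y * x⁻¹)

/-- The right action of `Y` on the set `X`: `us ◃ vt = ((s ◃ v)ts⁻¹ ▹ u⁻¹)⁻¹ (s ◃ v)`. -/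
def ractY (x : X) (y : G × Mᵐᵒᵖ) : X :=
  let u := gPart h x
  let s := mPart h x
  let v := y.1
  let t := y.2.unop
  (lact h (ract h s v * t * s⁻¹) u⁻¹ : X)⁻¹ * ract h s v

theorem ractY_eq (x : X) (y : G × Mᵐᵒᵖ) :
    ractY h x y = (gPart h (x * (toY h).symm y * x⁻¹) : X)⁻¹ * (x * y.1) := by
  have e1 : x = gPart h x * mPart h x := (gPart_mul_mPart h x).symm
  have e2 : (mPart h x : X) * y.1 = lact h (mPart h x) y.1 * ract h (mPart h x) y.1 :=
    (gPart_mul_mPart h _).symm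
  have e3 : x * (toY h).symm y * x⁻¹ = ((gPart h x * lact h (mPart h x) y.1 : G) : X) *
      ((ract h (mPart h x) y.1 * y.2.unop * (mPart h x)⁻¹ : M) * ((gPart h x)⁻¹ : G)) := by
    change x * (y.1 * (y.2.unop : X)) * x⁻¹ = _
    calc x * (y.1 * (y.2.unop : X)) * x⁻¹
        = gPart h x * (mPart h x * y.1) * y.2.unop * (mPart h x : X)⁻¹ * (gPart h x : X)⁻¹ := by
          conv_lhs => rw [e1]
          group
      _ = _ := by
          rw [e2]
          simp only [Subgroup.coe_mul, InvMemClass.coe_inv]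
          group
  have e4 : x * y.1 = gPart h x * (lact h (mPart h x) y.1 * ract h (mPart h x) y.1) := by
    rw [← e2, ← mul_assoc, ← e1]
  rw [e3, gPart_coe_mul, e4]
  change (gPart h _ : X)⁻¹ * _ = _
  simp only [Subgroup.coe_mul]
  group

theorem toY_symm_mul (y z : G × Mᵐᵒᵖ) :
    (toY h).symm (y * z) = y.1 * (toY h).symm z * y.2.unop := by
  simp [toY, mul_assoc]

theorem toY_symm_eq (y : G × Mᵐᵒᵖ) : (toY h).symm y = y.1 * (y.2.unop : X) := rfl

theorem toY_symm_one : (toY h).symm 1 = 1 := by simp [toY]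

theorem lactY_fst (x : X) (y : G × Mᵐᵒᵖ) :
    (lactY h x y).1 = gPart h (x * (toY h).symm y * x⁻¹) := rfl

theorem lactY_snd (x : X) (y : G × Mᵐᵒᵖ) :
    (lactY h x y).2.unop = mPart h (x * (toY h).symm y * x⁻¹) := rfl

theorem symm_lactY (x : X) (y : G × Mᵐᵒᵖ) :
    (toY h).symm (lactY h x y) = x * (toY h).symm y * x⁻¹ := by simp [lactY]

theorem ractY_eq' (x : X) (y : G × Mᵐᵒᵖ) :
    ractY h x y = ((lactY h x y).1 : X)⁻¹ * (x * y.1) := ractY_eq h x y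

theorem lactY_mul (x : X) (y z : G × Mᵐᵒᵖ) :
    lactY h x (y * z) = lactY h x y * lactY h (ractY h x y) z := by
  apply (toY h).symm.injective
  have e : (x * (y.1 * (y.2.unop : X)) * x⁻¹) =
      (lactY h x y).1 * (lactY h x y).2.unop := (symm_lactY h x y).symm
  have e' : ((lactY h x y).2.unop : X) =
      ((lactY h x y).1 : X)⁻¹ * (x * (y.1 * (y.2.unop : X)) * x⁻¹) := by rw [e]; group
  rw [toY_symm_mul, symm_lactY, symm_lactY, toY_symm_mul, ractY_eq', e']
  group

/-- The matched pair of the groups `X` and `Y = G × Mᵒᵖ`. -/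
def matchedPair : MatchedPair X (G × Mᵐᵒᵖ) where
  lact := lactY h
  ract := ractY h
  ract_one s := by
    rw [ractY_eq, toY_symm_one, mul_one, mul_inv_cancel, gPart_one]
    simp
  ract_ract s u v := by
    rw [ractY_eq' h _ v, ractY_eq' h s (u * v), lactY_mul, ractY_eq' h s u]
    simp only [Prod.fst_mul, Subgroup.coe_mul]
    group
  one_ract u := by
    rw [ractY_eq, one_mul, one_mul, inv_one, mul_one,
      (part_unique h u.1 u.2.unop (toY_symm_eq h u).symm).1]
    simp
  mul_ract s t u := by
    have e : lactY h (s * t) u = lactY h s (lactY h t u) := by simp [lactY, mul_assoc]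
    rw [ractY_eq' h (s * t), e, ractY_eq' h s, ractY_eq' h t]
    group
  one_lact u := by simp [lactY]
  lact_lact s t u := by simp [lactY, mul_assoc]
  lact_one s := by
    apply (toY h).symm.injective
    rw [symm_lactY, toY_symm_one]
    simp
  lact_mul := lactY_mul h

instance [Fintype M] : Fintype Mᵐᵒᵖ := Fintype.ofEquiv M MulOpposite.opEquiv

variable (k : Type*) [Field k]

/-- The element `x ⊗ δ_y` of `kX ▷◀ k(Y)`, for `x, y ∈ X`, with `y` viewed in `Y`. -/
def el (x y : X) : Bicross k (matchedPair h) := Bicross.el k x (toY h y)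

/-- `R = ∑ v⁻¹ ⊗ δ_{us} ⊗ s⁻¹ ⊗ δ_{(s ▹ v)t}`, over `u, v ∈ G` and `s, t ∈ M`. -/
def rMatrix [Fintype G] [Fintype M] :
    Bicross k (matchedPair h) ⊗[k] Bicross k (matchedPair h) :=
  ∑ u : G, ∑ s : M, ∑ v : G, ∑ t : M,
    el h k (v : X)⁻¹ (u * s) ⊗ₜ[k] el h k (s : X)⁻¹ (lact h s v * t)

end Factorisation

end

/-! The matrix `R` contains exactly one term `f(y,z) ⊗ δ_y ⊗ g(y,z) ⊗ δ_z` for each pair (y,z) in Y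
× Y. Writing y = us and letting w be the G-component of z, the labels are g = s⁻¹ and f = v⁻¹, where
v is the G-component of s⁻¹w. Sums of this shape are closed under multiplication: labels multiply
while the maps (y,z) ↦ (f ▹ y, g ▹ z) compose. Comparing labels over fixed δ-indices therefore turns
each quasitriangularity axiom into pointwise identities for the matched pair
(`isQuasitriangular_tensorSum`).

Two facts carry these identities. First, G is the coset space X/M with X acting by left translation,
so `gPart (x * gPart y) = gPart (x * y)`. Second, f is the inverse of the G-component of g ▹ z
(`fstLeg_eq`), which gives the braiding relation (g ▹ z)(f ▹ y) = yz in Y (`lactY_legs_mul`). That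
relation matches `R` with the coproduct and leaves only the terms with yz = 1 in the Drinfeld
element.

For the Killing form, the product R₂₁R has the same shape. Either label, together with its own
δ-index, determines (y,z). Since |X| = |Y|, the matrix of R₂₁R in the basis of H is a permutation
matrix, hence non-degenerate. The Drinfeld element is central because conjugation by x fixes x. -/

open scoped TensorProduct

noncomputable section

/-! ### Labelled sums over pairs and triples of δ-indices. -/

namespace Bicross

variable {k : Type*} [Field k] {M G : Type*} [Group M] [Group G] {P : MatchedPair M G} [Fintype G]

variable (k P) in
/-- The element `∑ f(y, z) ⊗ δ_y ⊗ g(y, z) ⊗ δ_z` of `H ⊗ H`. -/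
def tensorSum (f g : G → G → M) : Bicross k P ⊗[k] Bicross k P :=
  ∑ y : G, ∑ z : G, el k (f y z) y ⊗ₜ[k] el k (g y z) z

variable (k P) in
/-- The element `∑ f(x, y, z) ⊗ δ_x ⊗ g(x, y, z) ⊗ δ_y ⊗ j(x, y, z) ⊗ δ_z` of `H ⊗ H ⊗ H`. -/
def tensorSum₃ (f g j : G → G → G → M) : Bicross k P ⊗[k] (Bicross k P ⊗[k] Bicross k P) :=
  ∑ x : G, ∑ y : G, ∑ z : G,
    el k (f x y z) x ⊗ₜ[k] (el k (g x y z) y ⊗ₜ[k] el k (j x y z) z)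

theorem tensorSum_mul_tmul (f g : G → G → M) (a b : M) (y z : G) :
    tensorSum k P f g * (el k a y ⊗ₜ[k] el k b z) =
      el k (f (P.lact a y) (P.lact b z) * a) y ⊗ₜ[k]
        el k (g (P.lact a y) (P.lact b z) * b) z := by
  classical
  simp [tensorSum, Finset.sum_mul, el_mul_el, TensorProduct.ite_tmul, TensorProduct.tmul_ite]

/-- The right factor keeps its δ-indices, and only the left term indexed by their images under `f'`
and `g'` survives. So one label per pair is again enough. -/
theorem tensorSum_mul (f g f' g' : G → G → M) :
    tensorSum k P f g * tensorSum k P f' g' =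
      tensorSum k P
        (fun y z => f (P.lact (f' y z) y) (P.lact (g' y z) z) * f' y z)
        (fun y z => g (P.lact (f' y z) y) (P.lact (g' y z) z) * g' y z) := by
  rw [tensorSum.eq_def k P f']
  simp only [Finset.mul_sum, tensorSum_mul_tmul]
  rfl

theorem sum_mul₃ {ι : Type*} (s : Finset ι)
    (F : ι → Bicross k P ⊗[k] (Bicross k P ⊗[k] Bicross k P)) (a) :
    (∑ i ∈ s, F i) * a = ∑ i ∈ s, F i * a :=
  map_sum (LinearMap.mulRight k a) F s

theorem mul_sum₃ {ι : Type*} (s : Finset ι)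
    (F : ι → Bicross k P ⊗[k] (Bicross k P ⊗[k] Bicross k P)) (a) :
    a * (∑ i ∈ s, F i) = ∑ i ∈ s, a * F i :=
  map_sum (LinearMap.mulLeft k a) F s

theorem tensorSum₃_mul_tmul (f g j : G → G → G → M) (a b c : M) (x y z : G) :
    tensorSum₃ k P f g j * (el k a x ⊗ₜ[k] (el k b y ⊗ₜ[k] el k c z)) =
      el k (f (P.lact a x) (P.lact b y) (P.lact c z) * a) x ⊗ₜ[k]
        (el k (g (P.lact a x) (P.lact b y) (P.lact c z) * b) y ⊗ₜ[k]
          el k (j (P.lact a x) (P.lact b y) (P.lact c z) * c) z) := by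
  classical
  simp [tensorSum₃, sum_mul₃, el_mul_el, TensorProduct.ite_tmul, TensorProduct.tmul_ite]

theorem tensorSum₃_mul (f g j f' g' j' : G → G → G → M) :
    tensorSum₃ k P f g j * tensorSum₃ k P f' g' j' =
      tensorSum₃ k P
        (fun x y z => f (P.lact (f' x y z) x) (P.lact (g' x y z) y) (P.lact (j' x y z) z) *
          f' x y z)
        (fun x y z => g (P.lact (f' x y z) x) (P.lact (g' x y z) y) (P.lact (j' x y z) z) *
          g' x y z)
        (fun x y z => j (P.lact (f' x y z) x) (P.lact (g' x y z) y) (P.lact (j' x y z) z) *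
          j' x y z) := by
  rw [tensorSum₃.eq_def k P f']
  simp only [mul_sum₃, tensorSum₃_mul_tmul]
  rfl

theorem one_eq_tensorSum :
    (1 : Bicross k P ⊗[k] Bicross k P) = tensorSum k P (fun _ _ => 1) (fun _ _ => 1) := by
  simp only [Algebra.TensorProduct.one_def, one_def, tensorSum, TensorProduct.sum_tmul,
    TensorProduct.tmul_sum]
  exact Finset.sum_comm

theorem isUnit_tensorSum (f g : G → G → M)
    (hfg : Function.Injective fun p : G × G => (P.lact (f p.1 p.2) p.1, P.lact (g p.1 p.2) p.2)) :
    IsUnit (tensorSum k P f g) := by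
  let e := Equiv.ofBijective _ (Finite.injective_iff_bijective.1 hfg)
  have he : ∀ p : G × G,
      P.lact (f (e.symm p).1 (e.symm p).2) (e.symm p).1 = p.1 ∧
        P.lact (g (e.symm p).1 (e.symm p).2) (e.symm p).2 = p.2 := fun p =>
    Prod.ext_iff.1 (e.apply_symm_apply p)
  have he' : ∀ y z, e.symm (P.lact (f y z) y, P.lact (g y z) z) = (y, z) := fun y z =>
    e.symm_apply_apply (y, z)
  have hinv : ∀ (s : M) (u v : G), P.lact s u = v → P.lact s⁻¹ v = u := by
    rintro s u v rfl
    rw [P.lact_lact, inv_mul_cancel, P.one_lact]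
  -- The inverse acts at a pair by undoing the labels attached to its preimage under the bijection
  -- `e`.
  refine isUnit_iff_exists.2 ⟨tensorSum k P
    (fun y z => (f (e.symm (y, z)).1 (e.symm (y, z)).2)⁻¹)
    (fun y z => (g (e.symm (y, z)).1 (e.symm (y, z)).2)⁻¹), ?_, ?_⟩
  · rw [tensorSum_mul, one_eq_tensorSum]
    simp only [fun y z => hinv _ _ _ (he (y, z)).1, fun y z => hinv _ _ _ (he (y, z)).2,
      mul_inv_cancel]
  · rw [tensorSum_mul, one_eq_tensorSum]
    simp only [he', inv_mul_cancel]

theorem leg₁₂_tensorSum (f g : G → G → M) :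
    QuasiHopf.leg₁₂ k (tensorSum k P f g) =
      tensorSum₃ k P (fun x y _ => f x y) (fun x y _ => g x y) (fun _ _ _ => 1) := by
  simp [QuasiHopf.leg₁₂, tensorSum, tensorSum₃, one_def, TensorProduct.tmul_sum]

theorem leg₁₃_tensorSum (f g : G → G → M) :
    QuasiHopf.leg₁₃ k (tensorSum k P f g) =
      tensorSum₃ k P (fun x _ z => f x z) (fun _ _ _ => 1) (fun x _ z => g x z) := by
  simp only [QuasiHopf.leg₁₃, tensorSum, tensorSum₃, one_def, TensorProduct.tmul_sum, map_sum,
    Algebra.TensorProduct.map_tmul, AlgHom.id_apply, Algebra.TensorProduct.includeRight_apply,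
    TensorProduct.sum_tmul]
  exact Finset.sum_congr rfl fun x _ => Finset.sum_comm

theorem leg₂₃_tensorSum (f g : G → G → M) :
    QuasiHopf.leg₂₃ k (tensorSum k P f g) =
      tensorSum₃ k P (fun _ _ _ => 1) (fun _ y z => f y z) (fun _ y z => g y z) := by
  simp only [QuasiHopf.leg₂₃, tensorSum, tensorSum₃, one_def, map_sum,
    Algebra.TensorProduct.includeRight_apply, TensorProduct.sum_tmul]
  conv_rhs => rw [Finset.sum_comm]
  refine Finset.sum_congr rfl fun y _ => ?_
  conv_rhs => rw [Finset.sum_comm]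

theorem comul_rTensor_tensorSum (f g : G → G → M) :
    TensorProduct.assoc k _ _ _ ((Coalgebra.comul (R := k)).rTensor _ (tensorSum k P f g)) =
      tensorSum₃ k P (fun x y z => f (x * y) z) (fun x y z => P.ract (f (x * y) z) x)
        (fun x y z => g (x * y) z) := by
  simp only [tensorSum, tensorSum₃, map_sum, LinearMap.rTensor_tmul, comul_el,
    TensorProduct.sum_tmul, TensorProduct.assoc_tmul]
  conv_lhs => enter [2, y]; rw [Finset.sum_comm]
  rw [Finset.sum_comm]
  refine Finset.sum_congr rfl fun x _ => ?_
  exact Fintype.sum_equiv (Equiv.mulLeft x⁻¹) _ _ fun y => by simp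

theorem comul_lTensor_tensorSum (f g : G → G → M) :
    (Coalgebra.comul (R := k)).lTensor _ (tensorSum k P f g) =
      tensorSum₃ k P (fun x y z => f x (y * z)) (fun x y z => g x (y * z))
        (fun x y z => P.ract (g x (y * z)) y) := by
  simp only [tensorSum, tensorSum₃, map_sum, LinearMap.lTensor_tmul, comul_el,
    TensorProduct.tmul_sum]
  refine Finset.sum_congr rfl fun x _ => ?_
  rw [Finset.sum_comm]
  refine Finset.sum_congr rfl fun y _ => ?_
  exact Fintype.sum_equiv (Equiv.mulLeft y⁻¹) _ _ fun z => by simp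

theorem comm_tensorSum (f g : G → G → M) :
    TensorProduct.comm k _ _ (tensorSum k P f g) =
      tensorSum k P (fun y z => g z y) (fun y z => f z y) := by
  simp only [tensorSum, map_sum, TensorProduct.comm_tmul]
  exact Finset.sum_comm

theorem tensorSum_mul_comul (f g : G → G → M) (s : M) (u : G) :
    tensorSum k P f g * Coalgebra.comul (R := k) (el k s u : Bicross k P) =
      ∑ y : G, el k (f (P.lact s y) (P.lact (P.ract s y) (y⁻¹ * u)) * s) y ⊗ₜ[k]
        el k (g (P.lact s y) (P.lact (P.ract s y) (y⁻¹ * u)) * P.ract s y) (y⁻¹ * u) := by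
  simp only [comul_el, Finset.mul_sum, tensorSum_mul_tmul]

open Classical in
theorem comm_comul_mul_tmul (s a b : M) (u y z : G) :
    TensorProduct.comm k _ _ (Coalgebra.comul (R := k) (el k s u : Bicross k P)) *
        (el k a y ⊗ₜ[k] el k b z) =
      if P.lact b z * P.lact a y = u then
        el k (P.ract s (P.lact b z) * a) y ⊗ₜ[k] el k (s * b) z else 0 := by
  simp only [comul_el, map_sum, TensorProduct.comm_tmul, Finset.sum_mul,
    Algebra.TensorProduct.tmul_mul_tmul, el_mul_el]
  rw [Finset.sum_eq_single (P.lact b z)]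
  · by_cases h : P.lact b z * P.lact a y = u
    · simp [← h]
    · have : ¬ (P.lact b z)⁻¹ * u = P.lact a y := fun h' => h (by simp [← h'])
      simp [h, this]
  · intro x _ hx
    simp [hx]
  · simp

/-! ### Pointwise criteria for the R-matrix, the Drinfeld element and non-degeneracy. -/

theorem isQuasitriangular_tensorSum (f g : G → G → M)
    (hmul : ∀ y z, P.lact (g y z) z * P.lact (f y z) y = y * z)
    (hinj : Function.Injective fun p : G × G => (P.lact (f p.1 p.2) p.1, P.lact (g p.1 p.2) p.2))
    (left_f : ∀ x y z, f (x * y) z = f x (P.lact (g y z) z))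
    (left_ract : ∀ x y z, P.ract (f (x * y) z) x = f y z)
    (left_g : ∀ x y z, g (x * y) z = g x (P.lact (g y z) z) * g y z)
    (right_f : ∀ x y z, f x (y * z) = f (P.lact (f x y) x) z * f x y)
    (right_g : ∀ x y z, g x (y * z) = g x y)
    (right_ract : ∀ x y z, P.ract (g x (y * z)) y = g (P.lact (f x y) x) z)
    (op_f : ∀ s y z, P.ract s (P.lact (g y z) z) * f y z =
      f (P.lact s y) (P.lact (P.ract s y) z) * s)
    (op_g : ∀ s y z, s * g y z = g (P.lact s y) (P.lact (P.ract s y) z) * P.ract s y) :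
    QuasiHopf.IsQuasitriangular k (tensorSum k P f g) where
  isUnit := isUnit_tensorSum f g hinj
  comul_left := by
    rw [comul_rTensor_tensorSum, leg₁₃_tensorSum, leg₂₃_tensorSum, tensorSum₃_mul]
    simp only [P.one_lact, mul_one, one_mul, ← left_f, left_ract, ← left_g]
  comul_right := by
    rw [comul_lTensor_tensorSum, leg₁₃_tensorSum, leg₁₂_tensorSum, tensorSum₃_mul]
    simp only [P.one_lact, mul_one, one_mul, ← right_f, right_ract]
    simp only [right_g]
  comul_op a := by
    classical
    induction a using induct with
    | zero => simp
    | add a b ha hb => simp [add_mul, mul_add, ha, hb]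
    | smul c a ha => simp [ha]
    | ofEl s u =>
      rw [tensorSum_mul_comul]
      conv_lhs => rw [tensorSum]
      -- By `hmul` the surviving terms are those with `y * z = u`, exactly the pairs that occur in
      -- the coproduct of `el k s u`.
      simp only [Finset.mul_sum, comm_comul_mul_tmul, hmul]
      refine Finset.sum_congr rfl fun y _ => ?_
      rw [Finset.sum_eq_single (y⁻¹ * u)]
      · rw [if_pos (mul_inv_cancel_left _ _), op_f, op_g]
      · intro z _ hz
        rw [if_neg fun h => hz (by rw [← h, inv_mul_cancel_left])]
      · simp

open Classical in
/-- The Drinfeld element only sees the terms with `y z = 1`. -/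
theorem drinfeld_tensorSum (f g : G → G → M)
    (hmul : ∀ y z, P.lact (g y z) z * P.lact (f y z) y = y * z) :
    QuasiHopf.drinfeld k (tensorSum k P f g) =
      ∑ y : G, el k ((P.ract (g y y⁻¹) y⁻¹)⁻¹ * f y y⁻¹) y := by
  simp only [QuasiHopf.drinfeld, tensorSum, map_sum, TensorProduct.comm_tmul,
    LinearMap.rTensor_tmul, antipode_el, LinearMap.mul'_apply, el_mul_el, inv_eq_iff_mul_eq_one,
    hmul]
  refine Finset.sum_congr rfl fun y _ => ?_
  rw [Finset.sum_eq_single y⁻¹]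
  · simp
  · intro z _ hz
    rw [if_neg fun h => hz (eq_inv_of_mul_eq_one_right h)]
  · simp

/-- Counting upgrades both injections to bijections onto the basis index set, so each basis element
occurs exactly once in each leg. Testing against the coordinate functional of its partner then
isolates one value of the other functional. -/
theorem dualForm_tensorSum_nondegenerate [Finite M] (f g : G → G → M)
    (hf : Function.Injective fun p : G × G => (f p.1 p.2, p.1))
    (hg : Function.Injective fun p : G × G => (g p.1 p.2, p.2))
    (hcard : Nat.card M = Nat.card G) :
    (QuasiHopf.dualForm k (tensorSum k P f g)).Nondegenerate := by
  have hcard' : Nat.card (G × G) = Nat.card (M × G) := by simp [Nat.card_prod, hcard]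
  have hf' := (hf.bijective_of_nat_card_le hcard'.ge).2
  have hg' := (hg.bijective_of_nat_card_le hcard'.ge).2
  have key : ∀ φ ψ, QuasiHopf.dualForm k (tensorSum k P f g) φ ψ =
      ∑ p : G × G, φ (el k (f p.1 p.2) p.1) * ψ (el k (g p.1 p.2) p.2) := by
    simp [QuasiHopf.dualForm, tensorSum, Fintype.sum_prod_type]
  refine ⟨fun φ hφ => (basis k P).ext fun q => ?_, fun ψ hψ => (basis k P).ext fun q => ?_⟩
  · classical
    obtain ⟨p, rfl⟩ := hf' q
    have := hφ ((basis k P).coord (g p.1 p.2, p.2))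
    rw [key, Finset.sum_eq_single p] at this
    · simpa [el] using this
    · intro r _ hr
      simp [el, show ¬ (g r.1 r.2, r.2) = (g p.1 p.2, p.2) from
        fun h => hr (hg h)]
    · simp
  · classical
    obtain ⟨p, rfl⟩ := hg' q
    have := hψ ((basis k P).coord (f p.1 p.2, p.1))
    rw [key, Finset.sum_eq_single p] at this
    · simpa [el] using this
    · intro r _ hr
      simp [el, show ¬ (f r.1 r.2, r.1) = (f p.1 p.2, p.1) from
        fun h => hr (hf h)]
    · simp

end Bicross

/-! ### The translation action of X on G viewed as X/M. -/

namespace Factorisation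

variable {X : Type*} [Group X] {G M : Subgroup X} (h : G.IsComplement' M)

theorem gPart_mul_coe (x : X) (s : M) : gPart h (x * s) = gPart h x := by
  simpa using gPart_mul_mul h 1 x s

theorem gPart_coe (u : G) : gPart h (u : X) = u := by
  simpa [gPart_one] using gPart_coe_mul h u 1

theorem mPart_coe_mul (u : G) (x : X) : mPart h (u * x) = mPart h x :=
  (part_unique h (u * gPart h x) (mPart h x) (by
    rw [Subgroup.coe_mul, mul_assoc, gPart_mul_mPart])).2

theorem mPart_coe (s : M) : mPart h (s : X) = s :=
  (part_unique h 1 s (by simp)).2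

theorem coe_mPart (x : X) : (mPart h x : X) = (gPart h x : X)⁻¹ * x := by
  rw [eq_inv_mul_iff_mul_eq, gPart_mul_mPart]

/-- `gPart` depends only on the coset modulo M, and y and its G-component lie in the same coset. -/
theorem gPart_mul_gPart (x y : X) : gPart h (x * gPart h y) = gPart h (x * y) := by
  conv_rhs => rw [← gPart_mul_mPart h y, ← mul_assoc, gPart_mul_coe]

/-- The left translations of `X` act on `G = X / M`, hence by injective maps. -/
theorem gPart_mul_left_injective (x : X) : Function.Injective fun u : G => gPart h (x * u) := by
  intro u v huv
  have := congrArg (fun g : G => gPart h (x⁻¹ * g)) huv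
  simpa only [gPart_mul_gPart, inv_mul_cancel_left, gPart_coe] using this

/-! ### Pointwise identities for the two labels of R. -/

/-- The index `v⁻¹` of the first leg of `R`, in terms of `us` and `(s ▹ v)t`. -/
def fstLeg (y z : G × Mᵐᵒᵖ) : X := (gPart h ((y.2.unop : X)⁻¹ * z.1) : X)⁻¹

/-- The index `s⁻¹` of the second leg of `R`, in terms of `us` and `(s ▹ v)t`. -/
def sndLeg (y _z : G × Mᵐᵒᵖ) : X := (y.2.unop : X)⁻¹

theorem gPart_conj_unop_inv (s : M) (z : G × Mᵐᵒᵖ) :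
    gPart h ((s : X)⁻¹ * (toY h).symm z * s) = gPart h ((s : X)⁻¹ * z.1) := by
  rw [gPart_mul_coe, toY_symm_eq, ← mul_assoc, gPart_mul_coe]

theorem lactY_sndLeg_fst (y z : G × Mᵐᵒᵖ) :
    (lactY h (sndLeg y z) z).1 = gPart h ((y.2.unop : X)⁻¹ * z.1) := by
  rw [lactY_fst, sndLeg, inv_inv, gPart_conj_unop_inv]

theorem fstLeg_eq (y z : G × Mᵐᵒᵖ) : fstLeg h y z = ((lactY h (sndLeg y z) z).1 : X)⁻¹ := by
  rw [lactY_sndLeg_fst, fstLeg]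

theorem coe_lactY_snd (x : X) (y : G × Mᵐᵒᵖ) :
    ((lactY h x y).2.unop : X) = ((lactY h x y).1 : X)⁻¹ * (x * (toY h).symm y * x⁻¹) := by
  rw [lactY_snd, coe_mPart, lactY_fst]

/-- Write y = us and g ▹ z = s⁻¹zs = wm with w in G and m in M, so that f = w⁻¹. The product in Y is
w(w⁻¹yw)m = y s⁻¹zs = uzs, which is yz in Y. -/
theorem lactY_legs_mul (y z : G × Mᵐᵒᵖ) :
    lactY h (sndLeg y z) z * lactY h (fstLeg h y z) y = y * z := by
  apply (toY h).symm.injective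
  rw [toY_symm_mul, toY_symm_mul, symm_lactY, coe_lactY_snd, fstLeg_eq, sndLeg, toY_symm_eq h y]
  group

theorem lactY_injective (x : X) : Function.Injective (lactY h x) :=
  (matchedPair h).lact_injective x

theorem lactY_legs_injective :
    Function.Injective fun p : (G × Mᵐᵒᵖ) × (G × Mᵐᵒᵖ) =>
      (lactY h (fstLeg h p.1 p.2) p.1, lactY h (sndLeg p.1 p.2) p.2) := by
  rintro ⟨y, z⟩ ⟨y', z'⟩ e
  obtain ⟨e1, e2⟩ := Prod.ext_iff.1 e
  simp only at e1 e2
  -- The first label depends only on the second image, so it is common to both pairs. This recovers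
  -- y, hence the second label, hence z.
  rw [fstLeg_eq, fstLeg_eq, e2] at e1
  obtain rfl := lactY_injective h _ e1
  obtain rfl := lactY_injective h _ e2
  rfl

theorem fstLeg_mul_left (x y z : G × Mᵐᵒᵖ) :
    fstLeg h (x * y) z = fstLeg h x (lactY h (sndLeg y z) z) := by
  rw [fstLeg, fstLeg, lactY_sndLeg_fst, gPart_mul_gPart]
  simp [mul_assoc]

theorem sndLeg_mul_left (x y z w : G × Mᵐᵒᵖ) :
    (sndLeg (x * y) z : X) = sndLeg x w * sndLeg y z := by
  simp [sndLeg]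

theorem ractY_fstLeg (x y z : G × Mᵐᵒᵖ) : ractY h (fstLeg h (x * y) z) x = fstLeg h y z := by
  have e : gPart h (fstLeg h (x * y) z * (toY h).symm x * (fstLeg h (x * y) z)⁻¹) =
      (gPart h (((x * y).2.unop : X)⁻¹ * z.1))⁻¹ * (x.1 * gPart h ((y.2.unop : X)⁻¹ * z.1)) := by
    rw [fstLeg, inv_inv, gPart_mul_gPart, toY_symm_eq, ← InvMemClass.coe_inv, mul_assoc,
      gPart_coe_mul, mul_assoc, gPart_coe_mul]
    simp [mul_assoc]
  rw [ractY_eq, e, fstLeg, fstLeg]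
  simp only [Subgroup.coe_mul, InvMemClass.coe_inv]
  group

/-- The labels see their first argument only through its M-component, so this is all that is needed
to evaluate them at f ▹ y. -/
theorem coe_lactY_fstLeg_snd (y z : G × Mᵐᵒᵖ) :
    ((lactY h (fstLeg h y z) y).2.unop : X) = (fstLeg h y z * (y.2.unop : X)⁻¹ * z.1)⁻¹ := by
  have e : (lactY h (fstLeg h y z) y).1 =
      (gPart h ((y.2.unop : X)⁻¹ * z.1))⁻¹ * (y.1 * z.1) := by
    rw [lactY_fst, fstLeg, inv_inv, gPart_mul_gPart, toY_symm_eq, ← InvMemClass.coe_inv, mul_assoc,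
      gPart_coe_mul, mul_assoc, gPart_coe_mul, mul_inv_cancel_left, gPart_coe]
  rw [coe_lactY_snd, e, toY_symm_eq]
  simp only [Subgroup.coe_mul, InvMemClass.coe_inv, fstLeg]
  group

theorem fstLeg_mul_right (x y z : G × Mᵐᵒᵖ) :
    fstLeg h x (y * z) = fstLeg h (lactY h (fstLeg h x y) x) z * fstLeg h x y := by
  rw [fstLeg.eq_def h (lactY h _ x), coe_lactY_fstLeg_snd, inv_inv, mul_assoc, mul_assoc,
    fstLeg.eq_def h x y, ← InvMemClass.coe_inv (gPart h ((x.2.unop : X)⁻¹ * y.1)), gPart_coe_mul,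
    fstLeg]
  simp [mul_assoc]

theorem ractY_sndLeg (x y z : G × Mᵐᵒᵖ) :
    ractY h (sndLeg x (y * z)) y = sndLeg (lactY h (fstLeg h x y) x) z := by
  rw [sndLeg.eq_def (lactY h _ x), coe_lactY_fstLeg_snd, inv_inv, ractY_eq, sndLeg, inv_inv,
    gPart_conj_unop_inv, fstLeg, mul_assoc]

theorem mul_sndLeg (x : X) (y z : G × Mᵐᵒᵖ) :
    x * sndLeg y z = sndLeg (lactY h x y) (lactY h (ractY h x y) z) * ractY h x y := by
  rw [sndLeg, sndLeg, coe_lactY_snd, ractY_eq', toY_symm_eq]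
  group

/-- Both sides equal c⁻¹x, where c is the G-component of x(g ▹ z)x⁻¹: on the left the G-component of
g ▹ z cancels against f. -/
theorem ractY_mul_fstLeg (x : X) (y z : G × Mᵐᵒᵖ) :
    ractY h x (lactY h (sndLeg y z) z) * fstLeg h y z =
      fstLeg h (lactY h x y) (lactY h (ractY h x y) z) * x := by
  have e : gPart h (((lactY h x y).2.unop : X)⁻¹ * (lactY h (ractY h x y) z).1) =
      gPart h (x * (toY h).symm (lactY h (sndLeg y z) z) * x⁻¹) := by
    rw [lactY_fst, gPart_mul_gPart, symm_lactY, coe_lactY_snd, ractY_eq' h x y]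
    have : ((((lactY h x y).1 : X)⁻¹ * (x * (toY h).symm y * x⁻¹))⁻¹ *
        (((lactY h x y).1 : X)⁻¹ * (x * y.1) * (toY h).symm z *
          (((lactY h x y).1 : X)⁻¹ * (x * y.1))⁻¹)) =
        x * sndLeg y z * (toY h).symm z * (y.1 : X)⁻¹ * x⁻¹ * (lactY h x y).1 := by
      rw [sndLeg, toY_symm_eq h y]
      group
    rw [this, lactY_fst, gPart_mul_gPart, sndLeg, toY_symm_eq h y]
    congr 1
    group
  rw [fstLeg.eq_def h (lactY h x y), e, ractY_eq, fstLeg_eq]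
  group

/-! ### The R-matrix and its Drinfeld element. -/

variable (k : Type*) [Field k]

/-- For fixed s the map v ↦ s ▹ v permutes G, so (us, (s ▹ v)t) runs once through Y × Y. -/
theorem rMatrix_eq_tensorSum [Fintype G] [Fintype M] :
    rMatrix h k = Bicross.tensorSum k (matchedPair h) (fstLeg h) sndLeg := by
  rw [rMatrix, Bicross.tensorSum, Fintype.sum_prod_type]
  refine Finset.sum_congr rfl fun u _ => ?_
  refine Fintype.sum_equiv MulOpposite.opEquiv _ _ fun s => ?_
  rw [Fintype.sum_prod_type]
  refine Fintype.sum_bijective (lact h s)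
    (Finite.injective_iff_bijective.1 (gPart_mul_left_injective h s)) _ _ fun v => ?_
  refine Fintype.sum_equiv MulOpposite.opEquiv _ _ fun t => ?_
  have e1 : ∀ (g : G) (m : M), toY h (g * m) = (g, MulOpposite.op m) := fun g m =>
    (toY h).apply_symm_apply (g, MulOpposite.op m)
  have e2 : fstLeg h (u, MulOpposite.op s) (lact h s v, MulOpposite.op t) = (v : X)⁻¹ := by
    simp only [fstLeg, lact, MulOpposite.unop_op, gPart_mul_gPart, inv_mul_cancel_left, gPart_coe]
  rw [el, el, e1, e1]
  simp only [MulOpposite.opEquiv_apply, e2]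
  rfl

theorem isQuasitriangular_rMatrix [Fintype G] [Fintype M] :
    QuasiHopf.IsQuasitriangular k (rMatrix h k) := by
  rw [rMatrix_eq_tensorSum]
  exact Bicross.isQuasitriangular_tensorSum (P := matchedPair h) _ _ (lactY_legs_mul h)
    (lactY_legs_injective h) (fstLeg_mul_left h) (ractY_fstLeg h)
    (fun x y z => sndLeg_mul_left x y z _) (fstLeg_mul_right h) (fun _ _ _ => rfl)
    (ractY_sndLeg h) (ractY_mul_fstLeg h) (mul_sndLeg h)

theorem drinfeld_rMatrix [Fintype X] [Fintype G] [Fintype M] :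
    QuasiHopf.drinfeld k (rMatrix h k) = ∑ x : X, el h k x x := by
  rw [rMatrix_eq_tensorSum, Bicross.drinfeld_tensorSum (P := matchedPair h) _ _ (lactY_legs_mul h)]
  refine (Fintype.sum_equiv (toY h) _ _ fun x => ?_).symm
  obtain ⟨y, rfl⟩ := (toY h).symm.surjective x
  rw [el, Equiv.apply_symm_apply]
  congr 1
  change _ = (ractY h (sndLeg y y⁻¹) y⁻¹)⁻¹ * fstLeg h y y⁻¹
  rw [ractY_eq', fstLeg_eq, sndLeg, toY_symm_eq]
  simp only [Prod.fst_inv, InvMemClass.coe_inv]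
  group

theorem drinfeld_rMatrix_mem_center [Fintype X] [Fintype G] [Fintype M] :
    QuasiHopf.drinfeld k (rMatrix h k) ∈ Subalgebra.center k (Bicross k (matchedPair h)) := by
  classical
  rw [drinfeld_rMatrix, Subalgebra.mem_center_iff]
  intro a
  induction a using Bicross.induct with
  | zero => simp
  | add a b ha hb => rw [add_mul, mul_add, ha, hb]
  | smul c a ha => rw [smul_mul_assoc, mul_smul_comm, ha]
  | ofEl x y =>
    -- Since z fixes itself under conjugation, one product keeps only z = y, the other only z =
    -- xyx⁻¹. Both leave `xy ⊗ δ_y`.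
    have e1 : ∀ z : X, y = (matchedPair h).lact z (toY h z) ↔ (toY h).symm y = z := fun z => by
      change y = lactY h z (toY h z) ↔ _
      rw [lactY, Equiv.symm_apply_apply, mul_inv_cancel_right, Equiv.symm_apply_eq]
    have e2 : ∀ z : X, toY h z = (matchedPair h).lact x y ↔ z = x * (toY h).symm y * x⁻¹ :=
      fun z => (toY h).injective.eq_iff
    simp only [Finset.mul_sum, Finset.sum_mul, el, Bicross.el_mul_el, e1, e2, Finset.sum_ite_eq,
      Finset.sum_ite_eq', Finset.mem_univ, if_true, Equiv.apply_symm_apply, inv_mul_cancel_right]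

/-! ### The quantum inverse Killing form. -/

/-- The index of the second leg of `R₂₁ R`. -/
def killingSnd (y z : G × Mᵐᵒᵖ) : X :=
  (gPart h ((y.2.unop : X)⁻¹ * ((toY h).symm z)⁻¹ * y.2.unop * y.1 * z.1) : X)⁻¹ *
    (y.2.unop : X)⁻¹

theorem killing_rMatrix_eq_tensorSum [Fintype G] [Fintype M] :
    QuasiHopf.killing k (rMatrix h k) = Bicross.tensorSum k (matchedPair h)
      (fun y z => (y.2.unop : X)⁻¹ * ((toY h).symm z)⁻¹ * y.2.unop) (killingSnd h) := by
  rw [QuasiHopf.killing, rMatrix_eq_tensorSum, Bicross.comm_tensorSum, Bicross.tensorSum_mul]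
  congr 1 <;> funext y z
  · change ((lactY h (sndLeg y z) z).2.unop : X)⁻¹ * fstLeg h y z = _
    rw [coe_lactY_snd, fstLeg_eq, sndLeg]
    group
  · change (gPart h (((lactY h (sndLeg y z) z).2.unop : X)⁻¹ * (lactY h (fstLeg h y z) y).1) : X)⁻¹
      * (y.2.unop : X)⁻¹ = _
    have e : ((lactY h (sndLeg y z) z).2.unop : X)⁻¹ *
        (fstLeg h y z * (toY h).symm y * (fstLeg h y z)⁻¹) =
        (y.2.unop : X)⁻¹ * ((toY h).symm z)⁻¹ * y.2.unop * (toY h).symm y *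
          (gPart h ((y.2.unop : X)⁻¹ * z.1) : X) := by
      rw [coe_lactY_snd, fstLeg_eq, lactY_sndLeg_fst, sndLeg]
      group
    rw [killingSnd, lactY_fst, gPart_mul_gPart, e, gPart_mul_gPart, toY_symm_eq h y]
    congr 4
    group

theorem dualForm_killing_nondegenerate [Fintype X] [Fintype G] [Fintype M] :
    (QuasiHopf.dualForm k (QuasiHopf.killing k (rMatrix h k))).Nondegenerate := by
  rw [killing_rMatrix_eq_tensorSum]
  refine Bicross.dualForm_tensorSum_nondegenerate _ _ ?_ ?_ (Nat.card_congr (toY h))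
  · rintro ⟨y, z⟩ ⟨y', z'⟩ e
    obtain ⟨e1, e2⟩ := Prod.ext_iff.1 e
    obtain rfl : y = y' := e2
    simpa using e1
  · rintro ⟨⟨u, s⟩, z⟩ ⟨⟨u', s'⟩, z'⟩ e
    obtain ⟨e1, e2⟩ := Prod.ext_iff.1 e
    obtain rfl : z = z' := e2
    -- The second label is an element of G times s⁻¹, so its components give s and a left translate
    -- of uw, with w the G-component of z. Translations are injective on G, which recovers u.
    have e3 := congrArg (gPart h) e1
    have e4 := congrArg (mPart h) e1
    simp only [killingSnd, ← InvMemClass.coe_inv, gPart_mul_coe, mPart_coe_mul, mPart_coe,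
      gPart_coe, inv_inj, MulOpposite.unop_inj] at e3 e4
    subst e4
    simp only [mul_assoc _ (u : X), mul_assoc _ (u' : X), ← Subgroup.coe_mul] at e3
    have := gPart_mul_left_injective h _ e3
    rw [mul_right_cancel this]

theorem killing_rMatrix [Fintype X] [Fintype G] [Fintype M] :
    QuasiHopf.killing k (rMatrix h k) = ∑ u : G, ∑ v : G, ∑ s : M, ∑ p : M,
      el h k ((s : X)⁻¹ * (u : X)⁻¹) (u * lact h s v * ract h p u * (u : X)⁻¹) ⊗ₜ[k]
        el h k ((v : X)⁻¹ * (p : X)⁻¹) (p * u * s * (p : X)⁻¹) := by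
  have hm : ∀ (u v : G) (s p : M),
      mPart h (u * lact h s v * ract h p u * (u : X)⁻¹) = p := fun u v s p => by
    -- From pu = (p ▹ u)(p ◃ u) follows (p ◃ u)u⁻¹ = (p ▹ u)⁻¹p.
    have : (u * lact h s v * ract h p u * (u : X)⁻¹ : X) =
        (u * lact h s v * (lact h p u)⁻¹ : G) * p := by
      rw [ract, coe_mPart, ← lact]
      simp only [Subgroup.coe_mul, InvMemClass.coe_inv]
      group
    rw [this, mPart_coe_mul, mPart_coe]
  -- The δ-indices of the stated formula reparametrise Y × Y: p is the M-component of the first, the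
  -- second then gives us, and finally the first gives v.
  let φ : G × G × M × M → (G × Mᵐᵒᵖ) × (G × Mᵐᵒᵖ) := fun q =>
    (toY h (q.1 * lact h q.2.2.1 q.2.1 * ract h q.2.2.2 q.1 * (q.1 : X)⁻¹),
      toY h (q.2.2.2 * q.1 * q.2.2.1 * (q.2.2.2 : X)⁻¹))
  have hφ : Function.Bijective φ := by
    rw [Fintype.bijective_iff_injective_and_card]
    constructor
    · rintro ⟨u, v, s, p⟩ ⟨u', v', s', p'⟩ e
      obtain ⟨e1, e2⟩ := Prod.ext_iff.1 e
      replace e1 := (toY h).injective e1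
      replace e2 := (toY h).injective e2
      simp only at e1 e2
      obtain rfl : p = p' := by rw [← hm u v s p, e1, hm]
      have e2' : (u * s : X) = u' * s' := by
        rw [mul_assoc (p : X) u, mul_assoc (p : X) u'] at e2
        exact mul_left_cancel (mul_right_cancel e2)
      obtain ⟨rfl, rfl⟩ := Prod.ext_iff.1 (h.1 (a₁ := (u, s)) (a₂ := (u', s')) e2')
      obtain rfl : v = v' := gPart_mul_left_injective h s (Subtype.ext
        (mul_left_cancel (mul_right_cancel (mul_right_cancel e1))))
      rfl
    · simp only [Fintype.card_prod, Fintype.card_congr (MulOpposite.opEquiv (α := M)).symm]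
      ring
  rw [killing_rMatrix_eq_tensorSum, Bicross.tensorSum, ← Fintype.sum_prod_type',
    ← (Equiv.ofBijective φ hφ).sum_comp]
  simp only [Fintype.sum_prod_type, Equiv.ofBijective_apply]
  refine Finset.sum_congr rfl fun u _ => Finset.sum_congr rfl fun v _ =>
    Finset.sum_congr rfl fun s _ => Finset.sum_congr rfl fun p _ => ?_
  have e1 : (φ (u, v, s, p)).1.2.unop = p := hm u v s p
  have e2 : (toY h).symm (φ (u, v, s, p)).2 = (p : X) * u * s * (p : X)⁻¹ :=
    (toY h).symm_apply_apply _
  have e3 : gPart h ((p : X)⁻¹ * ((p : X) * u * s * (p : X)⁻¹)⁻¹ * p * (φ (u, v, s, p)).1.1 *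
      (φ (u, v, s, p)).2.1) = v := by
    have e4 : ((φ (u, v, s, p)).1.1 : X) =
        u * lact h s v * ract h p u * (u : X)⁻¹ * (p : X)⁻¹ := by
      have := gPart_mul_mPart h (u * lact h s v * ract h p u * (u : X)⁻¹)
      rw [hm] at this
      exact eq_mul_inv_of_mul_eq this
    -- Once the inner `gPart` is absorbed, the argument is s⁻¹(s ▹ v) times an element of M, and
    -- s⁻¹(s ▹ v) lies in the coset of v.
    have e5 : (p : X)⁻¹ * ((p : X) * u * s * (p : X)⁻¹)⁻¹ * p *
        (u * lact h s v * ract h p u * (u : X)⁻¹ * (p : X)⁻¹) *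
        ((p : X) * u * s * (p : X)⁻¹) =
        (s : X)⁻¹ * gPart h (s * v) * (ract h p u * s * p⁻¹ : M) := by
      rw [lact]
      simp only [Subgroup.coe_mul, InvMemClass.coe_inv]
      group
    change gPart h (_ * (gPart h ((p : X) * u * s * (p : X)⁻¹) : X)) = v
    rw [gPart_mul_gPart, e4, e5, gPart_mul_coe, gPart_mul_gPart, inv_mul_cancel_left, gPart_coe]
  rw [killingSnd, e1, e2, e3]
  simp only [el]
  congr 2
  group

end Factorisation

end

theorem corollary2p3 {k : Type*} [Field k] {X : Type*} [Group X] [Fintype X]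
    (G M : Subgroup X) [Fintype G] [Fintype M] (h : G.IsComplement' M) :
    QuasiHopf.IsQuasitriangular k (Factorisation.rMatrix h k) ∧
    QuasiHopf.killing k (Factorisation.rMatrix h k) =
      ∑ u : G, ∑ v : G, ∑ s : M, ∑ p : M,
        Factorisation.el h k ((s : X)⁻¹ * (u : X)⁻¹)
            (u * Factorisation.lact h s v * Factorisation.ract h p u * (u : X)⁻¹) ⊗ₜ[k]
          Factorisation.el h k ((v : X)⁻¹ * (p : X)⁻¹) (p * u * s * (p : X)⁻¹) ∧
    (QuasiHopf.dualForm k (QuasiHopf.killing k (Factorisation.rMatrix h k))).Nondegenerate ∧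
    QuasiHopf.drinfeld k (Factorisation.rMatrix h k) = ∑ x : X, Factorisation.el h k x x ∧
    QuasiHopf.drinfeld k (Factorisation.rMatrix h k) ∈
      Subalgebra.center k (Bicross k (Factorisation.matchedPair h)) :=
  ⟨Factorisation.isQuasitriangular_rMatrix h k, Factorisation.killing_rMatrix h k,
    Factorisation.dualForm_killing_nondegenerate h k, Factorisation.drinfeld_rMatrix h k,
    Factorisation.drinfeld_rMatrix_mem_center h k⟩
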